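/- Let $1\le r<n$ be integers. **Spaces and groups.** Let $\dot{\mathbf r}=\{\dot 0,\dots,\dot{(r-1)}\}$ be a set of $r$ dotted letters disjoint from $X=\{0,\dots,n-1\}$, let $\mathfrak C_n=X^{\mathbb N}$, and let $\mathfrak C_{n,r}=\dot{\mathbf r}\times\mathfrak C_n$ with the product topology, regarded as the space of infinite sequences $c\,a_1a_2\dots$ with $c\in\dot{\mathbf r}$, $a_i\in X$. Let $W$ be the set of finite words $c\,a_1\dots a_j$ ($j\ge 0$, $c\in\dot{\mathbf r}$, $a_i\in X$), and for $\eta\in W$ let $U_\eta=\{\eta x: x\in\mathfrak C_n\}$. A finite sequence $(\eta_0,\dots,\eta_{k-1})$ in $W$ is a maximal anti-chain if $\eta_i$ is not a prefix of $\eta_j$ for $i\ne j$ and every $\zeta\in W$ is comparable, in the prefix order, with some $\eta_i$. The Higman–Thompson group $G_{n,r}$ is the group of all homeomorphisms $g$ of $\mathfrak C_{n,r}$ for which there are maximal anti-chains $(\eta_i)_{i<k}$, $(\zeta_i)_{i<k}$ of the same length with $g(\eta_i x)=\zeta_i x$ for all $i<k$ and $x\in\mathfrak C_n$. **Transducers.**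 A transducer for $\mathfrak C_{n,r}$ is a tuple $A=(\dot{\mathbf r},X,R,S,\pi,\lambda,q_0)$ with disjoint state sets $R$ (finite) and $S$ (finite or countable), $Q=R\sqcup S$, an initial state $q_0\in R$, a transition function $\pi$ and an output function $\lambda$, both defined on $(\dot{\mathbf r}\times\{q_0\})\sqcup(X\times(Q\setminus\{q_0\}))$, where $\pi$ takes values in $Q\setminus\{q_0\}$ and $\lambda$ takes finite words as values; $\pi(w,q)$ and $\lambda(w,q)$ are extended in the usual way to all finite words $w$ that can be read from $q$, and $\lambda$ also to infinite ones. It is required that: (1) if $\pi(x,q)\in R$, then $q\in R$ and $\lambda(x,q)=\varepsilon$; (2) if $q\in R$ and $\pi(x,q)\in S$, then $\lambda(x,q)\in W$; (3) if $q\in S$, then $\pi(x,q)\in S$ and $\lambda(x,q)\in X^*$; (4) if $w\neq\varepsilon$ and $\pi(w,q)=q$, then $\lambda(w,q)\ne\varepsilon$; (5) if $q\in S$ and $x\in\mathfrak C_n$, then $\lambda(x,q)$ is infinite. Then $h_A(p)=\lambda(p,q_0)$ is a map $\mathfrak C_{n,r}\to\mathfrak C_{n,r}$, and $A$ is said to represent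 $h_A$. $A$ is finite if $Q$ is finite. $A$ is minimal if (a) it has no state of incomplete response: for every $\eta\in W$ the word $\lambda(\eta,q_0)$ is not a proper prefix of the greatest common prefix of the elements of $h_A(U_\eta)$; (b) every state other than $q_0$ is $\pi(\eta,q_0)$ for some $\eta\in W$; (c) any two states $p,q\ne q_0$ with $\lambda(x,p)=\lambda(x,q)$ for all $x\in\mathfrak C_n$ are equal. For $m\geq 1$, $A$ is synchronizing at level $m$ if for every word $w\in X^m$ the state $\pi(w,q)$ is the same for all $q\in Q\setminus\{q_0\}$. If $A$ represents a homeomorphism $\varphi$, then $A$ is bi-synchronizing at level $m$ if $A$ is synchronizing at level $m$ and $\varphi^{-1}$ is represented by some transducer for $\mathfrak C_{n,r}$ that is synchronizing at level $m$. **Theorem.** Let $\varphi:\mathfrak C_{n,r}\to\mathfrak C_{n,r}$ be a homeomorphism that is represented by a finite minimal transducer $A$ for $\mathfrak C_{n,r}$. Then $A$ is bi-synchronizing at level $m$ for some $m$ if and only if $\varphi$ belongs to the normaliser of $G_{n,r}$ in the group $\mathrm{Homeo}(\mathfrak C_{n,r})$ of all self-homeomorphisms of $\mathfrak C_{n,r}$.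 -/

import Mathlib

namespace HigmanThompson

/- ### Words and infinite sequences -/

/-- The infinite sequence obtained by writing the finite word `u` in front of `x`. -/
def prepend {α : Type*} : List α → (ℕ → α) → ℕ → α
  | [], x, i => x i
  | a :: _, _, 0 => a
  | _ :: u, x, i + 1 => prepend u x i

/-- The prefix of length `k` of an infinite sequence. -/
def takePrefix {α : Type*} (s : ℕ → α) (k : ℕ) : List α := (List.range k).map s

/-- The finite word `u` is a prefix of the infinite sequence `s`. -/
def IsPrefixOf {α : Type*} (u : List α) (s : ℕ → α) : Prop := takePrefix s u.length = u

/-- The root of a set of infinite sequences: the greatest common prefix `ρ` of its elements. -/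
def IsRoot {α : Type*} (U : Set (ℕ → α)) (ρ : List α) : Prop :=
  (∀ s ∈ U, IsPrefixOf ρ s) ∧ ∀ u : List α, (∀ s ∈ U, IsPrefixOf u s) → u <+: ρ

/-- The finite words `u 0, u 1, …` (successive contents of an output tape) exhaust the infinite
sequence `s`. -/
def IsLimitWord {α : Type*} (u : ℕ → List α) (s : ℕ → α) : Prop :=
  (∀ k, IsPrefixOf (u k) s) ∧ ∀ l : ℕ, ∃ k, l ≤ (u k).length

/- ### The Cantor space and the Higman–Thompson group -/

/-- The Cantor space `𝔠_{n,r}`: the points are the sequences `c a₁ a₂ a₃ …` with `c` one of `r`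
dotted letters and each `aᵢ` one of `n` ordinary letters; the topology is the product topology. -/
abbrev Cantor (n r : ℕ) : Type := Fin r × (ℕ → Fin n)

/-- The non-empty finite words that start with a dotted letter and continue with ordinary ones. -/
abbrev Word (n r : ℕ) : Type := Fin r × List (Fin n)

/-- The alphabet of dotted letters (`Sum.inl`) and ordinary letters (`Sum.inr`). -/
abbrev Letter (n r : ℕ) : Type := Fin r ⊕ Fin n

variable {n r : ℕ}

/-- A point of the Cantor space as an infinite sequence of letters. -/
def Cantor.toSeq (p : Cantor n r) : ℕ → Letter n r
  | 0 => Sum.inl p.1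
  | i + 1 => Sum.inr (p.2 i)

/-- The point `η ^ x`, for a word `η` and a sequence `x` of ordinary letters. -/
def Word.concat (η : Word n r) (x : ℕ → Fin n) : Cantor n r := (η.1, prepend η.2 x)

/-- The prefix order on words. -/
def Word.IsPrefix (η ζ : Word n r) : Prop := η.1 = ζ.1 ∧ η.2 <+: ζ.2

/-- `η₀, …, η_{k-1}` is a maximal anti-chain for the prefix order. -/
def IsMaximalAntichain {k : ℕ} (η : Fin k → Word n r) : Prop :=
  (∀ i j, i ≠ j → ¬ (η i).IsPrefix (η j)) ∧
    ∀ ζ : Word n r, ∃ i, (η i).IsPrefix ζ ∨ ζ.IsPrefix (η i)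

/-- `g` is the prefix code map that replaces the prefix `ηᵢ` by `ζᵢ`, for two maximal anti-chains
of the same length. -/
def IsPrefixCodeMap (g : Cantor n r ≃ₜ Cantor n r) : Prop :=
  ∃ (k : ℕ) (η ζ : Fin k → Word n r), IsMaximalAntichain η ∧ IsMaximalAntichain ζ ∧
    ∀ i x, g ((η i).concat x) = (ζ i).concat x

variable (n r) in
/-- The Higman–Thompson group `G_{n,r}`: all prefix code maps. -/
def higmanThompson : Set (Cantor n r ≃ₜ Cantor n r) := {g | IsPrefixCodeMap g}

/- ### Transducers for the Cantor space -/

/-- The data of an initial transducer. The set of all states is `P` together with one further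
state, the initial state `q₀`. Since `q₀` is never re-entered and is the only state which reads
dotted letters (and it reads nothing else), the transition and output functions split into a part
for `q₀` (`initStep`, `initOut`) and a part for the states in `P` (`step`, `out`). -/
structure TransducerData (n r : ℕ) (P : Type*) where
  /-- the set `R` without the initial state `q₀`; the set `S` is the complement of `R` in `P` -/
  R : Set P
  /-- `π(c, q₀)` -/
  initStep : Fin r → P
  /-- `λ(c, q₀)` -/
  initOut : Fin r → List (Letter n r)
  /-- `π(a, q)` for `q ≠ q₀` -/
  step : Fin n → P → P
  /-- `λ(a, q)` for `q ≠ q₀` -/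
  out : Fin n → P → List (Letter n r)

namespace TransducerData

variable {P : Type*} (A : TransducerData n r P)

/-- The state reached from `q` after reading a word of ordinary letters. -/
def stepWord : List (Fin n) → P → P
  | [], q => q
  | a :: w, q => stepWord w (A.step a q)

/-- The output written from `q` while reading a word of ordinary letters. -/
def outWord : List (Fin n) → P → List (Letter n r)
  | [], _ => []
  | a :: w, q => A.out a q ++ outWord w (A.step a q)

/-- The state reached from `q₀` after reading the word `η`. -/
def initStepWord (η : Word n r) : P := A.stepWord η.2 (A.initStep η.1)

/-- The output written from `q₀` while reading the word `η`. -/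
def initOutWord (η : Word n r) : List (Letter n r) :=
  A.initOut η.1 ++ A.outWord η.2 (A.initStep η.1)

/-- Reading the infinite input `x` from the state `q`, the infinite output is `s`. -/
def Writes (q : P) (x : ℕ → Fin n) (s : ℕ → Letter n r) : Prop :=
  IsLimitWord (fun k => A.outWord (takePrefix x k) q) s

/-- Reading the point `p` from the initial state `q₀`, the infinite output is `s`. -/
def InitWrites (p : Cantor n r) (s : ℕ → Letter n r) : Prop :=
  IsLimitWord (fun k => A.initOutWord (p.1, takePrefix p.2 k)) s

end TransducerData

/-- An initial (non-degenerate) transducer for `𝔠_{n,r}`. -/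
structure Transducer (n r : ℕ) (P : Type*) extends TransducerData n r P where
  /-- `R` is finite -/
  finite_R : R.Finite
  /-- `S` is finite or countably infinite -/
  countable_S : Rᶜ.Countable
  /-- a transition into `R` starts in `R` and writes nothing (case of the initial state) -/
  initOut_R : ∀ c, initStep c ∈ R → initOut c = []
  /-- a transition into `R` starts in `R` and writes nothing (case of the other states) -/
  out_R : ∀ a q, step a q ∈ R → q ∈ R ∧ out a q = []
  /-- a transition from `R` to `S` writes one dotted letter and then a word of ordinary letters
  (case of the initial state) -/
  initOut_S : ∀ c, initStep c ∉ R →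
    ∃ (d : Fin r) (u : List (Fin n)), initOut c = Sum.inl d :: u.map Sum.inr
  /-- a transition from `R` to `S` writes one dotted letter and then a word of ordinary letters
  (case of the other states) -/
  out_R_S : ∀ a, ∀ q ∈ R, step a q ∉ R →
    ∃ (d : Fin r) (u : List (Fin n)), out a q = Sum.inl d :: u.map Sum.inr
  /-- a transition from `S` writes a word of ordinary letters -/
  out_S : ∀ a, ∀ q ∉ R, ∃ u : List (Fin n), out a q = u.map Sum.inr
  /-- a non-empty word that labels a circuit produces non-empty output -/
  out_circuit : ∀ q w, w ≠ [] → toTransducerData.stepWord w q = q →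
    toTransducerData.outWord w q ≠ []
  /-- from a state in `S`, infinite inputs produce infinite outputs -/
  out_infinite : ∀ q ∉ R, ∀ x : ℕ → Fin n,
    ∃ y : ℕ → Fin n, toTransducerData.Writes q x (fun i => Sum.inr (y i))

namespace Transducer

variable {P : Type*} (A : Transducer n r P)

/-- The transducer represents the map `f`: on reading `p` from `q₀`, it writes `f p`. -/
def Represents (f : Cantor n r → Cantor n r) : Prop :=
  ∀ p, A.InitWrites p (f p).toSeq

/-- `q` is accessible from the initial state. -/
def IsAccessible (q : P) : Prop := ∃ η : Word n r, A.initStepWord η = q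

/-- `q` is a state of incomplete response: some word `η` leads from `q₀` to `q` with an output that
is a proper prefix of the root of the image of the cone of `η`. (The empty word, which leads only
to `q₀`, is not tested.) -/
def IsIncompleteResponse (q : P) : Prop :=
  ∃ (η : Word n r) (ρ : List (Letter n r)), A.initStepWord η = q ∧
    IsRoot {s | ∃ x, A.InitWrites (η.concat x) s} ρ ∧
    A.initOutWord η <+: ρ ∧ A.initOutWord η ≠ ρ

/-- Two states are equivalent if they induce the same map on infinite sequences. -/
def Equivalent (p q : P) : Prop := ∀ x s, A.Writes p x s ↔ A.Writes q x s

/-- A transducer is minimal if it has no states of incomplete response, all its states are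
accessible, and equivalent states are equal. (The initial state is accessible, and it is
equivalent to no other state, since it alone reads points of `𝔠_{n,r}`.) -/
def IsMinimal : Prop :=
  (∀ q, ¬ A.IsIncompleteResponse q) ∧ (∀ q, A.IsAccessible q) ∧ ∀ p q, A.Equivalent p q → p = q

/-- `A` is synchronizing at level `m ≥ 1`: the state reached after reading a word of length `m`
does not depend on the state, among those that can read the word, from which it is read. Words
that start with a dotted letter are read only from `q₀`, so they give no condition. -/
def IsSynchronizingAt (m : ℕ) : Prop :=
  0 < m ∧ ∀ w : List (Fin n), w.length = m → ∀ p q, A.stepWord w p = A.stepWord w q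

/-- `A`, which represents the homeomorphism `φ`, is bi-synchronizing at level `m`: it is
synchronizing at level `m`, and `φ⁻¹` is represented by some transducer that is synchronizing at
level `m`. -/
def IsBiSynchronizingAt (φ : Cantor n r ≃ₜ Cantor n r) (m : ℕ) : Prop :=
  A.Represents φ ∧ A.IsSynchronizingAt m ∧
    ∃ (P' : Type) (B : Transducer n r P'), B.Represents φ.symm ∧ B.IsSynchronizingAt m

end Transducer

end HigmanThompson

/-!
Both directions compare `φ` with its restrictions to small cones. For a homeomorphism `f` and a
word `η`, the *local action* of `f` at `η` is the map `x ↦ f (η ^ x)`, with the root of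
`f (U_η)` deleted from its values. The transducer whose states are the local actions represents
`f` (`actionTransducer`), and in every minimal transducer that represents `f` two words lead to the
same state if and only if `f` has the same local action at them
(`Transducer.IsMinimal.initStepWord_eq_iff`).

*Synchronizing transducers normalize.* An element `g` of the Higman–Thompson group replaces all
sufficiently long prefixes and leaves the rest of its argument alone, and it is characterized by
this. If `f` is represented by a transducer that is synchronizing at level `m`, then the points
`θ ^ u ^ y` and `g (θ ^ u ^ y) = θ' ^ u ^ y` with `u` of length `m` are read in the same way after
`u`, so that their images under `f` differ by a change of prefix. Hence `f g f⁻¹` belongs to the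
group (`Transducer.IsSynchronizingAt.conj_mem`). This is applied to `φ` and to `φ⁻¹`.

*Normalizing homeomorphisms synchronize.* For incomparable words `η` and `ζ` the exchange `g` of the
two prefixes belongs to the group. If `f g f⁻¹` belongs to it too, then
`f (ζ ^ x) = (f g f⁻¹) (f (η ^ x))` shows that `f` has the same local action at `η ^ w` and at
`ζ ^ w` for all long `w`. Comparable words are related through a third word
(`locallySynchronized`). If `f` has only finitely many local actions, then the necessary length of
`w` is bounded (`exists_synchronizing_level`), so that the transducer of local actions is
synchronizing. The homeomorphism `φ` has finitely many local actions, since the given transducer is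
finite and minimal. For `φ⁻¹` this follows by compactness (`finite_range_localAction_symm`): if `ν`
is the root of `φ⁻¹ (U_η)`, then the local action of `φ⁻¹` at `η` is determined by that of `φ` at
`ν` together with a word of bounded length.
-/

namespace HigmanThompson

/-! ### Finite words and infinite sequences -/

section Sequences

variable {α : Type*}

theorem prepend_append (u v : List α) (x : ℕ → α) :
    prepend (u ++ v) x = prepend u (prepend v x) := by
  induction u with
  | nil => funext i; rfl
  | cons a u ih => funext i; cases i with
    | zero => rfl
    | succ i => exact congrFun ih i

@[simp] theorem prepend_nil (x : ℕ → α) : prepend [] x = x := rfl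

theorem prepend_add_length (u : List α) (x : ℕ → α) (i : ℕ) :
    prepend u x (i + u.length) = x i := by
  induction u with
  | nil => rfl
  | cons a u ih => exact ih

theorem prepend_of_lt (u : List α) (x y : ℕ → α) {i : ℕ} (hi : i < u.length) :
    prepend u x i = prepend u y i := by
  induction u generalizing i with
  | nil => simp at hi
  | cons a u ih => cases i with
    | zero => rfl
    | succ i => exact ih (by simpa using hi)

theorem prepend_injective (u : List α) : Function.Injective (prepend u) := fun x y h => by
  funext i
  rw [← prepend_add_length u x i, h, prepend_add_length]

theorem prepend_map {β : Type*} (f : α → β) (u : List α) (x : ℕ → α) :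
    prepend (u.map f) (fun i => f (x i)) = fun i => f (prepend u x i) := by
  induction u with
  | nil => rfl
  | cons a u ih => funext i; cases i with
    | zero => rfl
    | succ i => exact congrFun ih i

@[simp] theorem length_takePrefix (s : ℕ → α) (k : ℕ) : (takePrefix s k).length = k := by
  simp [takePrefix]

@[simp] theorem takePrefix_zero (s : ℕ → α) : takePrefix s 0 = [] := rfl

theorem takePrefix_succ (s : ℕ → α) (k : ℕ) :
    takePrefix s (k + 1) = s 0 :: takePrefix (fun i => s (i + 1)) k := by
  simp [takePrefix, List.range_succ_eq_map, Function.comp_def]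

theorem prepend_takePrefix (s : ℕ → α) (k : ℕ) :
    prepend (takePrefix s k) (fun i => s (i + k)) = s := by
  induction k generalizing s with
  | zero => rfl
  | succ k ih =>
    rw [takePrefix_succ]
    funext i
    cases i with
    | zero => rfl
    | succ i => exact congrFun (ih fun i => s (i + 1)) i

theorem takePrefix_prepend_add (u : List α) (x : ℕ → α) (k : ℕ) :
    takePrefix (prepend u x) (u.length + k) = u ++ takePrefix x k := by
  induction u with
  | nil => simp
  | cons a u ih =>
    rw [List.length_cons, Nat.add_right_comm, takePrefix_succ]
    exact congrArg (a :: ·) ih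

theorem takePrefix_prepend (u : List α) (x : ℕ → α) :
    takePrefix (prepend u x) u.length = u := by
  simpa using takePrefix_prepend_add u x 0

theorem takePrefix_eq_takePrefix_iff {s t : ℕ → α} {k : ℕ} :
    takePrefix s k = takePrefix t k ↔ ∀ i < k, s i = t i := by
  simp [takePrefix]

theorem takePrefix_isPrefix (s : ℕ → α) {j k : ℕ} (h : j ≤ k) :
    takePrefix s j <+: takePrefix s k := by
  obtain ⟨d, rfl⟩ := Nat.exists_eq_add_of_le h
  have := takePrefix_prepend_add (takePrefix s j) (fun i => s (i + j)) d
  rw [prepend_takePrefix, length_takePrefix] at this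
  exact ⟨_, this.symm⟩

theorem isPrefixOf_iff {u : List α} {s : ℕ → α} : IsPrefixOf u s ↔ ∃ t, s = prepend u t := by
  constructor
  · intro h
    refine ⟨fun i => s (i + u.length), ?_⟩
    conv_rhs => rw [← h]
    rw [length_takePrefix, prepend_takePrefix]
  · rintro ⟨t, rfl⟩
    exact takePrefix_prepend u t

theorem isPrefixOf_prepend (u : List α) (x : ℕ → α) : IsPrefixOf u (prepend u x) :=
  takePrefix_prepend u x

theorem isPrefixOf_takePrefix (s : ℕ → α) (k : ℕ) : IsPrefixOf (takePrefix s k) s := by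
  simp [IsPrefixOf]

theorem IsPrefixOf.isPrefix {u v : List α} {s : ℕ → α} (hu : IsPrefixOf u s)
    (hv : IsPrefixOf v s) (h : u.length ≤ v.length) : u <+: v := by
  rw [← hu, ← hv]
  exact takePrefix_isPrefix s h

theorem IsPrefixOf.of_isPrefix {u v : List α} {s : ℕ → α} (h : u <+: v) (hv : IsPrefixOf v s) :
    IsPrefixOf u s := by
  obtain ⟨w, rfl⟩ := h
  obtain ⟨t, rfl⟩ := isPrefixOf_iff.1 hv
  rw [prepend_append]
  exact isPrefixOf_prepend _ _

theorem IsPrefixOf.comparable {u v : List α} {s : ℕ → α} (hu : IsPrefixOf u s)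
    (hv : IsPrefixOf v s) : u <+: v ∨ v <+: u :=
  (le_total u.length v.length).imp (hu.isPrefix hv) (hv.isPrefix hu)

theorem isPrefixOf_append_prepend {u v : List α} {x : ℕ → α} :
    IsPrefixOf (u ++ v) (prepend u x) ↔ IsPrefixOf v x := by
  simp only [isPrefixOf_iff, prepend_append, (prepend_injective u).eq_iff]

/-- Over an alphabet with two letters, the only words that are a prefix of all sequences
`v ^ x` are the prefixes of `v`. -/
theorem isPrefix_of_forall_isPrefixOf {β : Type*} [Nontrivial α] {f : α → β}
    (hf : Function.Injective f) {u v : List β}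
    (h : ∀ x : ℕ → α, IsPrefixOf u (prepend v fun i => f (x i))) : u <+: v := by
  obtain ⟨a, b, hab⟩ := exists_pair_ne α
  rcases le_total u.length v.length with hl | hl
  · exact (h fun _ => a).isPrefix (isPrefixOf_prepend _ _) hl
  · obtain ⟨w, rfl⟩ := (isPrefixOf_prepend v _).isPrefix (h fun _ => a) hl
    have h' := fun x => isPrefixOf_append_prepend.1 (h x)
    cases w with
    | nil => simp
    | cons c w =>
      have key : ∀ d : α, f d = c := fun d => by
        have := h' fun _ => d
        rw [IsPrefixOf, List.length_cons, takePrefix_succ] at this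
        exact (List.cons.inj this).1
      exact absurd (hf ((key a).trans (key b).symm)) hab

theorem IsLimitWord.unique {u : ℕ → List α} {s t : ℕ → α} (hs : IsLimitWord u s)
    (ht : IsLimitWord u t) : s = t := by
  funext i
  obtain ⟨k, hk⟩ := hs.2 (i + 1)
  have := (hs.1 k).trans (ht.1 k).symm
  exact takePrefix_eq_takePrefix_iff.1 this i hk

/-- The contents of an output tape may be inspected from any moment on. -/
theorem isLimitWord_shift {u : ℕ → List α} (hu : ∀ j k, j ≤ k → u j <+: u k) (N : ℕ)
    {s : ℕ → α} : IsLimitWord (fun k => u (N + k)) s ↔ IsLimitWord u s := by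
  constructor
  · rintro ⟨h₁, h₂⟩
    refine ⟨fun k => (h₁ k).of_isPrefix (hu _ _ (Nat.le_add_left _ _)), fun l => ?_⟩
    obtain ⟨k, hk⟩ := h₂ l
    exact ⟨N + k, hk⟩
  · rintro ⟨h₁, h₂⟩
    refine ⟨fun k => h₁ _, fun l => ?_⟩
    obtain ⟨k, hk⟩ := h₂ l
    exact ⟨k, hk.trans (hu k _ (Nat.le_add_left _ _)).length_le⟩

theorem isLimitWord_append {u : ℕ → List α} {v : List α} {s : ℕ → α} :
    IsLimitWord (fun k => v ++ u k) s ↔ ∃ t, s = prepend v t ∧ IsLimitWord u t := by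
  constructor
  · rintro ⟨h₁, h₂⟩
    obtain ⟨t, rfl⟩ := isPrefixOf_iff.1 ((h₁ 0).of_isPrefix (List.prefix_append _ _))
    refine ⟨t, rfl, fun k => isPrefixOf_append_prepend.1 (h₁ k), fun l => ?_⟩
    obtain ⟨k, hk⟩ := h₂ (v.length + l)
    exact ⟨k, by simpa using hk⟩
  · rintro ⟨t, rfl, h₁, h₂⟩
    refine ⟨fun k => isPrefixOf_append_prepend.2 (h₁ k), fun l => ?_⟩
    obtain ⟨k, hk⟩ := h₂ l
    exact ⟨k, by simp; omega⟩

end Sequences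

/-! ### Greatest common prefixes of families of sequences -/

section CommonPrefix

variable {Y β : Type*}

/-- The length of the greatest common prefix of a family of sequences: the first index at which
two members differ (and `0` for a constant family). -/
noncomputable def commonLength (h : Y → ℕ → β) : ℕ := sInf {i | ∃ x y, h x i ≠ h y i}

/-- The greatest common prefix of a family of sequences. -/
noncomputable def commonPrefix [Nonempty Y] (h : Y → ℕ → β) : List β :=
  takePrefix (h (Classical.arbitrary Y)) (commonLength h)

/-- The family obtained by deleting the greatest common prefix. -/
noncomputable def residual (h : Y → ℕ → β) : Y → ℕ → β := fun x i => h x (i + commonLength h)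

theorem eq_of_lt_commonLength {h : Y → ℕ → β} {i : ℕ} (hi : i < commonLength h) (x y : Y) :
    h x i = h y i := by
  have := Nat.notMem_of_lt_sInf hi
  simp only [Set.mem_ofPred_eq, not_exists, not_not] at this
  exact this x y

theorem prepend_commonPrefix [Nonempty Y] (h : Y → ℕ → β) (x : Y) :
    prepend (commonPrefix h) (residual h x) = h x := by
  have : commonPrefix h = takePrefix (h x) (commonLength h) :=
    takePrefix_eq_takePrefix_iff.2 fun i hi => eq_of_lt_commonLength hi _ _
  rw [this]
  exact prepend_takePrefix _ _

theorem residual_injective [Nonempty Y] {h : Y → ℕ → β} (hh : Function.Injective h) :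
    Function.Injective (residual h) := fun x y hxy => hh <| by
  rw [← prepend_commonPrefix h x, hxy, prepend_commonPrefix]

variable [Nontrivial Y]

theorem exists_ne_commonLength {h : Y → ℕ → β} (hh : Function.Injective h) :
    ∃ x y, h x (commonLength h) ≠ h y (commonLength h) := by
  refine Nat.sInf_mem (s := {i | ∃ x y, h x i ≠ h y i}) ?_
  obtain ⟨x, y, hxy⟩ := exists_pair_ne Y
  obtain ⟨i, hi⟩ := Function.ne_iff.1 (hh.ne hxy)
  exact ⟨i, x, y, hi⟩

theorem isPrefix_commonPrefix {h : Y → ℕ → β} (hh : Function.Injective h) {u : List β}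
    (hu : ∀ x, IsPrefixOf u (h x)) : u <+: commonPrefix h := by
  have hc : IsPrefixOf (commonPrefix h) (h (Classical.arbitrary Y)) := isPrefixOf_takePrefix _ _
  refine (hu _).isPrefix hc ?_
  by_contra! hlt
  obtain ⟨x, y, hxy⟩ := exists_ne_commonLength hh
  simp only [commonPrefix, length_takePrefix] at hlt
  exact hxy (takePrefix_eq_takePrefix_iff.1 ((hu x).trans (hu y).symm) _ hlt)

theorem commonLength_prepend {h : Y → ℕ → β} (hh : Function.Injective h) (u : List β) :
    commonLength (fun x => prepend u (h x)) = commonLength h + u.length := by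
  apply le_antisymm
  · obtain ⟨x, y, hxy⟩ := exists_ne_commonLength hh
    refine Nat.sInf_le ⟨x, y, ?_⟩
    simpa only [prepend_add_length] using hxy
  · obtain ⟨x, y, hxy⟩ := exists_ne_commonLength (h := fun x => prepend u (h x))
      ((prepend_injective u).comp hh)
    set N := commonLength fun x => prepend u (h x)
    by_contra! hlt
    rcases lt_or_ge N u.length with h₁ | h₁
    · exact hxy (prepend_of_lt u _ _ h₁)
    · obtain ⟨d, hd⟩ := Nat.exists_eq_add_of_le' h₁
      rw [hd, prepend_add_length, prepend_add_length] at hxy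
      exact hxy (eq_of_lt_commonLength (by omega) x y)

theorem commonPrefix_prepend {h : Y → ℕ → β} (hh : Function.Injective h) (u : List β) :
    commonPrefix (fun x => prepend u (h x)) = u ++ commonPrefix h := by
  rw [commonPrefix, commonLength_prepend hh, add_comm, takePrefix_prepend_add]
  rfl

theorem residual_prepend {h : Y → ℕ → β} (hh : Function.Injective h) (u : List β) :
    residual (fun x => prepend u (h x)) = residual h := by
  funext x i
  simp only [residual, commonLength_prepend hh, ← add_assoc, prepend_add_length]

/-- If two families differ only by a constant prefix, then they have the same residual. -/
theorem residual_eq_of_prepend {h h' k : Y → ℕ → β} {u u' : List β} (hh : Function.Injective h)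
    (hu : ∀ x, h x = prepend u (k x)) (hu' : ∀ x, h' x = prepend u' (k x)) :
    residual h = residual h' := by
  have hk : Function.Injective k := fun x y hxy => hh (by rw [hu, hu, hxy])
  rw [funext hu, funext hu', residual_prepend hk, residual_prepend hk]

end CommonPrefix

/-! ### Cones and continuity in the Cantor space -/

section CantorSpace

variable {n r : ℕ}

/-- A word as a list of letters. -/
def Word.toList (η : Word n r) : List (Letter n r) := Sum.inl η.1 :: η.2.map Sum.inr

/-- The word `η ^ w`. -/
def Word.append (η : Word n r) (w : List (Fin n)) : Word n r := (η.1, η.2 ++ w)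

/-- The prefix of a point that consists of its dotted letter and of `k` ordinary letters. -/
def Cantor.take (p : Cantor n r) (k : ℕ) : Word n r := (p.1, takePrefix p.2 k)

theorem Word.concat_append (η : Word n r) (w : List (Fin n)) (x : ℕ → Fin n) :
    (η.append w).concat x = η.concat (prepend w x) :=
  congrArg (Prod.mk η.1) (prepend_append _ _ _)

theorem Word.isPrefix_iff {η ζ : Word n r} : η.IsPrefix ζ ↔ ∃ w, ζ = η.append w := by
  constructor
  · rintro ⟨h, w, hw⟩
    exact ⟨w, Prod.ext h.symm hw.symm⟩
  · rintro ⟨w, rfl⟩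
    exact ⟨rfl, w, rfl⟩

theorem Cantor.concat_take (p : Cantor n r) (k : ℕ) :
    (p.take k).concat (fun i => p.2 (i + k)) = p :=
  congrArg (Prod.mk p.1) (prepend_takePrefix _ _)

@[simp] theorem Cantor.length_take (p : Cantor n r) (k : ℕ) : (p.take k).2.length = k :=
  length_takePrefix _ _

theorem Word.take_concat (η : Word n r) (x : ℕ → Fin n) :
    (η.concat x).take η.2.length = η :=
  congrArg (Prod.mk η.1) (takePrefix_prepend _ _)

theorem Word.concat_injective (η : Word n r) : Function.Injective η.concat := fun _ _ h =>
  prepend_injective η.2 (Prod.ext_iff.1 h).2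

theorem Word.comparable_of_concat_eq {η ζ : Word n r} {x y : ℕ → Fin n}
    (h : η.concat x = ζ.concat y) : η.IsPrefix ζ ∨ ζ.IsPrefix η := by
  obtain ⟨h₁, h₂⟩ := Prod.ext_iff.1 h
  have hη : IsPrefixOf η.2 (prepend ζ.2 y) := by
    rw [show prepend ζ.2 y = prepend η.2 x from h₂.symm]
    exact isPrefixOf_prepend _ _
  exact (hη.comparable (isPrefixOf_prepend _ _)).imp (fun h => ⟨h₁, h⟩) fun h => ⟨h₁.symm, h⟩

theorem Word.toSeq_concat (η : Word n r) (x : ℕ → Fin n) :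
    (η.concat x).toSeq = prepend η.toList fun i => Sum.inr (x i) := by
  funext i
  cases i with
  | zero => rfl
  | succ i => exact (congrFun (prepend_map Sum.inr η.2 x) i).symm

theorem Cantor.toSeq_injective : Function.Injective (Cantor.toSeq (n := n) (r := r)) := by
  intro p q h
  refine Prod.ext (Sum.inl_injective (congrFun h 0)) (funext fun i => ?_)
  exact Sum.inr_injective (congrFun h (i + 1))

theorem Cantor.takePrefix_toSeq (p : Cantor n r) (k : ℕ) :
    takePrefix p.toSeq (k + 1) = (p.take k).toList := by
  rw [takePrefix_succ]
  simp [Cantor.toSeq, Cantor.take, Word.toList, takePrefix]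

@[simp] theorem Word.length_toList (η : Word n r) : η.toList.length = η.2.length + 1 := by
  simp [Word.toList]

theorem Word.toList_injective : Function.Injective (Word.toList (n := n) (r := r)) := by
  intro η ζ h
  obtain ⟨h₁, h₂⟩ := List.cons.inj h
  exact Prod.ext (Sum.inl_injective h₁) (List.map_injective_iff.2 Sum.inr_injective h₂)

/-- A non-empty prefix of a point is a word. -/
theorem IsPrefixOf.exists_word {u : List (Letter n r)} {p : Cantor n r}
    (h : IsPrefixOf u p.toSeq) (hu : u ≠ []) : ∃ η : Word n r, u = η.toList := by
  obtain ⟨k, hk⟩ := Nat.exists_eq_succ_of_ne_zero (List.length_pos_iff.2 hu).ne'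
  exact ⟨p.take k, by rw [← p.takePrefix_toSeq, ← Nat.succ_eq_add_one, ← hk, h]⟩

/-- A map which, on sequences of letters, writes a fixed word in front of its argument, is
of the form `x ↦ ζ ^ x`. -/
theorem exists_word_of_toSeq_eq [Nonempty (Fin n)] {F : (ℕ → Fin n) → Cantor n r}
    {u : List (Letter n r)} (h : ∀ x, (F x).toSeq = prepend u fun i => Sum.inr (x i)) :
    ∃ ζ : Word n r, ∀ x, F x = ζ.concat x := by
  have hu : u ≠ [] := by
    rintro rfl
    have := congrFun (h (Classical.arbitrary _)) 0
    simp [Cantor.toSeq] at this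
  obtain ⟨ζ, rfl⟩ := IsPrefixOf.exists_word (p := F (Classical.arbitrary _))
    (by rw [h]; exact isPrefixOf_prepend _ _) hu
  exact ⟨ζ, fun x => Cantor.toSeq_injective (by rw [h, ζ.toSeq_concat])⟩

theorem continuous_toSeq_apply (i : ℕ) : Continuous fun p : Cantor n r => p.toSeq i := by
  cases i with
  | zero => exact continuous_of_discreteTopology.comp continuous_fst
  | succ i =>
    exact continuous_of_discreteTopology.comp ((continuous_apply i).comp continuous_snd)

theorem isOpen_setOf_takePrefix_eq (u : List (Letter n r)) (k : ℕ) :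
    IsOpen {p : Cantor n r | takePrefix p.toSeq k = u} := by
  by_cases hu : ∃ q : Cantor n r, takePrefix q.toSeq k = u
  · obtain ⟨q, rfl⟩ := hu
    have : {p : Cantor n r | takePrefix p.toSeq k = takePrefix q.toSeq k} =
        ⋂ i ∈ Finset.range k, (fun p : Cantor n r => p.toSeq i) ⁻¹' {q.toSeq i} := by
      ext p
      simp [takePrefix_eq_takePrefix_iff]
    rw [this]
    exact isOpen_biInter_finset fun i _ =>
      (isOpen_discrete _).preimage (continuous_toSeq_apply i)
  · push Not at hu
    simp [hu]

theorem exists_cylinder_subset {p : Cantor n r} {V : Set (Cantor n r)} (hV : IsOpen V)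
    (hp : p ∈ V) : ∃ L, ∀ q : Cantor n r, takePrefix q.toSeq L = takePrefix p.toSeq L → q ∈ V := by
  obtain ⟨V₁, V₂, -, h₂, hp₁, hp₂, hsub⟩ := isOpen_prod_iff.1 hV p.1 p.2 hp
  obtain ⟨_, ⟨x, k, rfl⟩, hpx, hk⟩ :=
    (PiNat.isTopologicalBasis_cylinders fun _ : ℕ => Fin n).exists_subset_of_mem_open hp₂ h₂
  refine ⟨k + 1, fun q hq => hsub ⟨?_, hk ?_⟩⟩
  · have : q.1 = p.1 := Sum.inl_injective (takePrefix_eq_takePrefix_iff.1 hq 0 (by omega))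
    rwa [this]
  · rw [PiNat.mem_cylinder_iff] at hpx ⊢
    intro i hi
    rw [← hpx i hi]
    exact Sum.inr_injective (takePrefix_eq_takePrefix_iff.1 hq (i + 1) (by omega))

/-- Uniform continuity of the continuous self-maps of the Cantor space. -/
theorem exists_depth {f : Cantor n r → Cantor n r} (hf : Continuous f) (K : ℕ) :
    ∃ L, ∀ p q : Cantor n r, takePrefix p.toSeq L = takePrefix q.toSeq L →
      takePrefix (f p).toSeq K = takePrefix (f q).toSeq K := by
  -- The points near which depth `L` suffices form an increasing open cover.
  let U : ℕ → Set (Cantor n r) := fun L => {p | ∀ q, takePrefix q.toSeq L = takePrefix p.toSeq L →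
    takePrefix (f q).toSeq K = takePrefix (f p).toSeq K}
  have hU : ∀ L, IsOpen (U L) := fun L => isOpen_iff_mem_nhds.2 fun p hp => by
    filter_upwards [(isOpen_setOf_takePrefix_eq (takePrefix p.toSeq L) L).mem_nhds rfl]
      with q hq q' hq'
    rw [hp q' (hq'.trans hq), hp q hq]
  have hmono : Directed (· ⊆ ·) U := directed_of_isDirected_le fun L L' hL p hp q hq =>
    hp q (takePrefix_eq_takePrefix_iff.2 fun i hi =>
      takePrefix_eq_takePrefix_iff.1 hq i (hi.trans_le hL))
  have hcov : (Set.univ : Set (Cantor n r)) ⊆ ⋃ L, U L := fun p _ => by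
    obtain ⟨L, hL⟩ := exists_cylinder_subset
      ((isOpen_setOf_takePrefix_eq (takePrefix (f p).toSeq K) K).preimage hf)
      (show p ∈ _ from rfl)
    exact Set.mem_iUnion.2 ⟨L, hL⟩
  obtain ⟨L, hL⟩ := isCompact_univ.elim_directed_cover U hU hcov hmono
  exact ⟨L, fun p q hpq => hL (Set.mem_univ q) p hpq⟩

/-- A continuous self-map of the Cantor space maps small cones into small cones. -/
theorem exists_level [Nonempty (Fin n)] {f : Cantor n r → Cantor n r} (hf : Continuous f) (K : ℕ) :
    ∃ L, ∀ η : Word n r, L ≤ η.2.length →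
      ∃ ν : Word n r, ν.2.length = K ∧ ∀ x, ∃ y, f (η.concat x) = ν.concat y := by
  obtain ⟨L, hL⟩ := exists_depth hf (K + 1)
  refine ⟨L, fun η hη => ⟨(f (η.concat (Classical.arbitrary _))).take K, by simp, fun x => ?_⟩⟩
  have key : (f (η.concat x)).take K = (f (η.concat (Classical.arbitrary _))).take K := by
    apply Word.toList_injective
    rw [← Cantor.takePrefix_toSeq, ← Cantor.takePrefix_toSeq]
    refine hL _ _ (takePrefix_eq_takePrefix_iff.2 fun i hi => ?_)
    rw [Word.toSeq_concat, Word.toSeq_concat]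
    exact prepend_of_lt _ _ _ (by simp; omega)
  exact ⟨_, by rw [← key]; exact (Cantor.concat_take _ K).symm⟩

end CantorSpace

/-! ### The Higman–Thompson group -/

section Group

variable {n r : ℕ}

/-- The elements of the Higman–Thompson group replace all sufficiently long prefixes. -/
theorem exists_level_of_mem_higmanThompson {g : Cantor n r ≃ₜ Cantor n r}
    (hg : g ∈ higmanThompson n r) :
    ∃ L, ∀ η : Word n r, L ≤ η.2.length →
      ∃ ζ : Word n r, ∀ x, g (η.concat x) = ζ.concat x := by
  obtain ⟨k, η, ζ, hη, -, h⟩ := hg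
  refine ⟨Finset.univ.sup fun i => (η i).2.length, fun ξ hξ => ?_⟩
  obtain ⟨i, hi⟩ := hη.2 ξ
  have hle : (η i).2.length ≤ ξ.2.length :=
    (Finset.le_sup (f := fun i => (η i).2.length) (Finset.mem_univ i)).trans hξ
  have hpre : (η i).IsPrefix ξ := by
    rcases hi with hi | ⟨h₁, h₂⟩
    · exact hi
    · exact ⟨h₁.symm, (h₂.eq_of_length_le hle).symm ▸ List.prefix_rfl⟩
  obtain ⟨w, rfl⟩ := Word.isPrefix_iff.1 hpre
  exact ⟨(ζ i).append w, fun x => by rw [Word.concat_append, Word.concat_append, h]⟩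

/-- A homeomorphism which replaces all prefixes of some level is a prefix code map. -/
theorem mem_higmanThompson_of_level [Nonempty (Fin n)] {g : Cantor n r ≃ₜ Cantor n r} (L : ℕ)
    (h : ∀ η : Word n r, η.2.length = L → ∃ ζ : Word n r, ∀ x, g (η.concat x) = ζ.concat x) :
    g ∈ higmanThompson n r := by
  let e := Fintype.equivFin (Fin r × List.Vector (Fin n) L)
  let η : Fin _ → Word n r := fun i => ((e.symm i).1, (e.symm i).2.toList)
  have hlen : ∀ i, (η i).2.length = L := fun i => (e.symm i).2.toList_length
  have hinj : ∀ i j, η i = η j → i = j := fun i j hij => by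
    obtain ⟨h₁, h₂⟩ := Prod.ext_iff.1 hij
    exact e.symm.injective (Prod.ext h₁ (Subtype.ext h₂))
  have hsurj : ∀ ξ : Word n r, ξ.2.length = L → ∃ i, η i = ξ := fun ξ hξ =>
    ⟨e (ξ.1, ⟨ξ.2, hξ⟩), by simp [η, List.Vector.toList]⟩
  choose ζ hζ using fun i => h (η i) (hlen i)
  have hanti : ∀ i j x y, (η i).concat x = (η j).concat y → i = j := fun i j x y hxy => by
    apply hinj
    rw [← (η i).take_concat x, ← (η j).take_concat y, hxy, hlen, hlen]
  refine ⟨_, η, ζ, ⟨fun i j hij hp => ?_, fun ξ => ?_⟩, ⟨fun i j hij hp => ?_, fun ξ => ?_⟩, hζ⟩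
  · obtain ⟨w, hw⟩ := Word.isPrefix_iff.1 hp
    refine hij (hanti i j (prepend w (Classical.arbitrary _)) (Classical.arbitrary _) ?_)
    rw [hw, Word.concat_append]
  · obtain ⟨i, hi⟩ := hsurj ((ξ.concat (Classical.arbitrary _)).take L) (by simp)
    refine ⟨i, Word.comparable_of_concat_eq
      (y := Classical.arbitrary _) (x := fun i => (ξ.concat (Classical.arbitrary _)).2 (i + L)) ?_⟩
    rw [hi, Cantor.concat_take]
  · obtain ⟨w, hw⟩ := Word.isPrefix_iff.1 hp
    refine hij (hanti i j (prepend w (Classical.arbitrary _)) (Classical.arbitrary _) ?_)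
    apply g.injective
    rw [hζ, hζ, hw, Word.concat_append]
  · obtain ⟨i, hi⟩ := hsurj ((g.symm (ξ.concat (Classical.arbitrary _))).take L) (by simp)
    refine ⟨i, Word.comparable_of_concat_eq (y := Classical.arbitrary _)
      (x := fun i => (g.symm (ξ.concat (Classical.arbitrary _))).2 (i + L)) ?_⟩
    rw [← hζ, hi, Cantor.concat_take, Homeomorph.apply_symm_apply]

/-- The cone `U_η`. -/
def cone (η : Word n r) : Set (Cantor n r) := {p | p.take η.2.length = η}

theorem mem_cone_iff {η : Word n r} {p : Cantor n r} : p ∈ cone η ↔ ∃ x, p = η.concat x := by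
  constructor
  · intro h
    refine ⟨fun i => p.2 (i + η.2.length), ?_⟩
    conv_rhs => rw [← show p.take η.2.length = η from h]
    rw [Cantor.length_take, Cantor.concat_take]
  · rintro ⟨x, rfl⟩
    exact η.take_concat x

theorem isClopen_cone (η : Word n r) : IsClopen (cone η) := by
  have h : ∀ p : Cantor n r, p ∈ cone η ↔ takePrefix p.toSeq (η.2.length + 1) = η.toList :=
    fun p => by rw [Cantor.takePrefix_toSeq, Word.toList_injective.eq_iff]; rfl
  constructor
  · rw [← isOpen_compl_iff]
    refine isOpen_iff_mem_nhds.2 fun p hp => ?_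
    filter_upwards [(isOpen_setOf_takePrefix_eq (takePrefix p.toSeq (η.2.length + 1))
      (η.2.length + 1)).mem_nhds rfl] with q hq
    rw [Set.mem_compl_iff, h] at hp ⊢
    rwa [show takePrefix q.toSeq _ = _ from hq]
  · rw [show cone η = _ from Set.ext h]
    exact isOpen_setOf_takePrefix_eq _ _

theorem Word.continuous_concat (η : Word n r) : Continuous η.concat := by
  refine continuous_const.prodMk (continuous_pi fun i => ?_)
  rcases lt_or_ge i η.2.length with hi | hi
  · exact continuous_const.congr fun x => prepend_of_lt η.2 (fun _ => η.2[i]) x hi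
  · obtain ⟨d, rfl⟩ := Nat.exists_eq_add_of_le' hi
    simpa only [prepend_add_length] using continuous_apply d

open Classical in
/-- The map that exchanges the prefixes `η` and `ζ`, and fixes the points which have neither. -/
noncomputable def swapFun (η ζ : Word n r) (p : Cantor n r) : Cantor n r :=
  if p ∈ cone η then ζ.concat (fun i => p.2 (i + η.2.length))
  else if p ∈ cone ζ then η.concat (fun i => p.2 (i + ζ.2.length)) else p

theorem continuous_swapFun (η ζ : Word n r) : Continuous (swapFun η ζ) := by
  have hshift : ∀ k, Continuous fun (p : Cantor n r) i => p.2 (i + k) := fun k =>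
    continuous_pi fun i => (continuous_apply _).comp continuous_snd
  have hη := (isClopen_cone η).frontier_eq
  have hζ := (isClopen_cone ζ).frontier_eq
  classical
  refine Continuous.if (fun p hp => absurd hp (by simp [hη]))
    (ζ.continuous_concat.comp (hshift _)) ?_
  exact Continuous.if (fun p hp => absurd hp (by simp [hζ]))
    (η.continuous_concat.comp (hshift _)) continuous_id

variable {η ζ : Word n r}

theorem swapFun_left (x : ℕ → Fin n) : swapFun η ζ (η.concat x) = ζ.concat x := by
  rw [swapFun, if_pos (mem_cone_iff.2 ⟨x, rfl⟩)]
  exact congrArg _ (funext fun i => prepend_add_length _ _ _)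

theorem swapFun_right (h : Disjoint (cone η) (cone ζ)) (x : ℕ → Fin n) :
    swapFun η ζ (ζ.concat x) = η.concat x := by
  have hx : ζ.concat x ∈ cone ζ := mem_cone_iff.2 ⟨x, rfl⟩
  rw [swapFun, if_neg (Set.disjoint_right.1 h hx), if_pos hx]
  exact congrArg _ (funext fun i => prepend_add_length _ _ _)

theorem swapFun_of_notMem {p : Cantor n r} (hη : p ∉ cone η) (hζ : p ∉ cone ζ) :
    swapFun η ζ p = p := by
  rw [swapFun, if_neg hη, if_neg hζ]

theorem swapFun_involutive (h : Disjoint (cone η) (cone ζ)) :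
    Function.Involutive (swapFun η ζ) := by
  intro p
  by_cases hη : p ∈ cone η
  · obtain ⟨x, rfl⟩ := mem_cone_iff.1 hη
    rw [swapFun_left, swapFun_right h]
  · by_cases hζ : p ∈ cone ζ
    · obtain ⟨x, rfl⟩ := mem_cone_iff.1 hζ
      rw [swapFun_right h, swapFun_left]
    · rw [swapFun_of_notMem hη hζ, swapFun_of_notMem hη hζ]

/-- The exchange of two disjoint cones, as a homeomorphism. -/
noncomputable def swapHomeo (h : Disjoint (cone η) (cone ζ)) : Cantor n r ≃ₜ Cantor n r where
  toEquiv := (swapFun_involutive h).toPerm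
  continuous_toFun := continuous_swapFun η ζ
  continuous_invFun := continuous_swapFun η ζ

theorem swapHomeo_mem [Nonempty (Fin n)] (h : Disjoint (cone η) (cone ζ)) :
    swapHomeo h ∈ higmanThompson n r := by
  have hpre : ∀ {ξ θ : Word n r} {x}, ξ.concat x ∈ cone θ → θ.2.length ≤ ξ.2.length →
      θ.IsPrefix ξ := fun {ξ θ x} hx hle => by
    obtain ⟨y, hy⟩ := mem_cone_iff.1 hx
    obtain hc | ⟨h₁, h₂⟩ := Word.comparable_of_concat_eq hy.symm
    · exact hc
    · exact ⟨h₁.symm, (h₂.eq_of_length_le hle).symm ▸ List.prefix_rfl⟩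
  refine mem_higmanThompson_of_level (max η.2.length ζ.2.length) fun ξ hξ => ?_
  by_cases hη : ∃ x, ξ.concat x ∈ cone η
  · obtain ⟨x, hx⟩ := hη
    obtain ⟨w, rfl⟩ := Word.isPrefix_iff.1 (hpre hx (hξ ▸ le_max_left _ _))
    refine ⟨ζ.append w, fun y => ?_⟩
    rw [Word.concat_append, Word.concat_append]
    exact swapFun_left _
  by_cases hζ : ∃ x, ξ.concat x ∈ cone ζ
  · obtain ⟨x, hx⟩ := hζ
    obtain ⟨w, rfl⟩ := Word.isPrefix_iff.1 (hpre hx (hξ ▸ le_max_right _ _))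
    refine ⟨η.append w, fun y => ?_⟩
    rw [Word.concat_append, Word.concat_append]
    exact swapFun_right h _
  · push Not at hη hζ
    exact ⟨ξ, fun x => swapFun_of_notMem (hη x) (hζ x)⟩

/-- Two incomparable prefixes are exchanged by an element of the Higman–Thompson group. -/
theorem exists_mem_higmanThompson_of_incomparable [Nonempty (Fin n)]
    (h₁ : ¬ η.IsPrefix ζ) (h₂ : ¬ ζ.IsPrefix η) :
    ∃ g ∈ higmanThompson n r, ∀ x, g (η.concat x) = ζ.concat x := by
  have h : Disjoint (cone η) (cone ζ) := Set.disjoint_left.2 fun p hp hp' => by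
    obtain ⟨x, rfl⟩ := mem_cone_iff.1 hp
    obtain ⟨y, hy⟩ := mem_cone_iff.1 hp'
    exact (Word.comparable_of_concat_eq hy).elim h₁ h₂
  exact ⟨swapHomeo h, swapHomeo_mem h, fun x => swapFun_left x⟩

end Group

/-! ### Transducers -/

section Transducers

variable {n r : ℕ} {P : Type*}

namespace TransducerData

variable (A : TransducerData n r P)

theorem stepWord_append (u v : List (Fin n)) (q : P) :
    A.stepWord (u ++ v) q = A.stepWord v (A.stepWord u q) := by
  induction u generalizing q with
  | nil => rfl
  | cons a u ih => exact ih _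

theorem outWord_append (u v : List (Fin n)) (q : P) :
    A.outWord (u ++ v) q = A.outWord u q ++ A.outWord v (A.stepWord u q) := by
  induction u generalizing q with
  | nil => rfl
  | cons a u ih =>
    change A.out a q ++ A.outWord (u ++ v) _ = A.out a q ++ A.outWord u _ ++ _
    rw [ih, List.append_assoc]
    rfl

theorem initStepWord_append (η : Word n r) (w : List (Fin n)) :
    A.initStepWord (η.append w) = A.stepWord w (A.initStepWord η) :=
  A.stepWord_append _ _ _

theorem initOutWord_append (η : Word n r) (w : List (Fin n)) :
    A.initOutWord (η.append w) = A.initOutWord η ++ A.outWord w (A.initStepWord η) := by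
  simp only [initOutWord, initStepWord, Word.append, outWord_append, List.append_assoc]

/-- What is written on reading `η ^ x` is what is written on reading `η`, followed by what is
written on reading `x` from the state reached by `η`. -/
theorem initWrites_concat (η : Word n r) (x : ℕ → Fin n) (s : ℕ → Letter n r) :
    A.InitWrites (η.concat x) s ↔
      ∃ t, s = prepend (A.initOutWord η) t ∧ A.Writes (A.initStepWord η) x t := by
  have hmono : ∀ j k, j ≤ k → A.initOutWord ((η.concat x).take j) <+:
      A.initOutWord ((η.concat x).take k) := fun j k hjk => by
    obtain ⟨w, hw⟩ := takePrefix_isPrefix (η.concat x).2 hjk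
    have : (η.concat x).take k = ((η.concat x).take j).append w := Prod.ext rfl hw.symm
    rw [this, initOutWord_append]
    exact List.prefix_append _ _
  have heq : (fun k => A.initOutWord ((η.concat x).take (η.2.length + k))) =
      fun k => A.initOutWord η ++ A.outWord (takePrefix x k) (A.initStepWord η) := by
    funext k
    rw [← initOutWord_append]
    exact congrArg A.initOutWord (Prod.ext rfl (takePrefix_prepend_add _ _ _))
  refine (isLimitWord_shift hmono η.2.length).symm.trans ?_
  have h := isLimitWord_append (v := A.initOutWord η) (s := s)
    (u := fun k => A.outWord (takePrefix x k) (A.initStepWord η))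
  rw [← heq] at h
  exact h

end TransducerData

namespace Transducer

theorem IsSynchronizingAt.mono {A : Transducer n r P} {m k : ℕ} (h : A.IsSynchronizingAt m)
    (hmk : m ≤ k) : A.IsSynchronizingAt k := by
  refine ⟨h.1.trans_le hmk, fun w hw p q => ?_⟩
  rw [← List.take_append_drop (k - m) w, TransducerData.stepWord_append,
    TransducerData.stepWord_append]
  exact h.2 _ (by rw [List.length_drop, hw]; omega) _ _

theorem Represents.exists_writes {A : Transducer n r P} {f : Cantor n r → Cantor n r}
    (h : A.Represents f) (η : Word n r) (x : ℕ → Fin n) :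
    ∃ t, (f (η.concat x)).toSeq = prepend (A.initOutWord η) t ∧
      A.Writes (A.initStepWord η) x t :=
  (A.initWrites_concat η x _).1 (h _)

/-- If two words lead to the same state, then `f` acts below them by the same map, up to
the prefixes that have been written. -/
theorem Represents.toSeq_eq {A : Transducer n r P} {f : Cantor n r → Cantor n r}
    (h : A.Represents f) {η ζ : Word n r} (hq : A.initStepWord η = A.initStepWord ζ)
    {x : ℕ → Fin n} {t : ℕ → Letter n r}
    (ht : (f (η.concat x)).toSeq = prepend (A.initOutWord η) t) :
    (f (ζ.concat x)).toSeq = prepend (A.initOutWord ζ) t := by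
  obtain ⟨t₁, h₁, hw₁⟩ := h.exists_writes η x
  obtain ⟨t₂, h₂, hw₂⟩ := h.exists_writes ζ x
  rw [ht] at h₁
  rw [h₂, prepend_injective _ h₁, hw₂.unique (hq ▸ hw₁)]

/-- A homeomorphism represented by a synchronizing transducer conjugates the Higman–Thompson
group into itself: an element `g` of the group changes a prefix of its argument and leaves the
rest, and the transducer forgets the changed prefix after the next `m` letters. -/
theorem IsSynchronizingAt.conj_mem [Nontrivial (Fin n)] {A : Transducer n r P} {m : ℕ}
    (hA : A.IsSynchronizingAt m) {f g : Cantor n r ≃ₜ Cantor n r} (hf : A.Represents f)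
    (hg : g ∈ higmanThompson n r) : f * g * f⁻¹ ∈ higmanThompson n r := by
  obtain ⟨L, hL⟩ := exists_level_of_mem_higmanThompson hg
  -- Below level `K`, the first `L` letters of the preimage suffice for `g`, and another `m`
  -- letters synchronize `A`.
  obtain ⟨K, hK⟩ := exists_level f.symm.continuous (L + m)
  refine mem_higmanThompson_of_level K fun η hη => ?_
  obtain ⟨ν, hν, hνx⟩ := hK η hη.ge
  choose y hy using hνx
  obtain ⟨θ, u, rfl, hθ, hu⟩ : ∃ (θ : Word n r) (u : List (Fin n)), ν = θ.append u ∧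
      θ.2.length = L ∧ u.length = m := by
    refine ⟨(ν.1, ν.2.take L), ν.2.drop L, ?_, ?_, ?_⟩
    · exact Prod.ext rfl (List.take_append_drop _ _).symm
    · simp [hν]
    · simp [hν]
  obtain ⟨θ', hθ'⟩ := hL θ hθ.ge
  have hstate : A.initStepWord (θ.append u) = A.initStepWord (θ'.append u) := by
    rw [TransducerData.initStepWord_append, TransducerData.initStepWord_append]
    exact hA.2 u hu _ _
  have hfy : ∀ x, f ((θ.append u).concat (y x)) = η.concat x := fun x => by
    rw [← hy x, Homeomorph.apply_symm_apply]
  obtain ⟨w, hw⟩ : A.initOutWord (θ.append u) <+: η.toList := by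
    refine isPrefix_of_forall_isPrefixOf (Sum.inr_injective (α := Fin r) (β := Fin n)) fun x => ?_
    obtain ⟨t, ht, -⟩ := hf.exists_writes (θ.append u) (y x)
    rw [← Word.toSeq_concat, ← hfy, ht]
    exact isPrefixOf_prepend _ _
  refine exists_word_of_toSeq_eq (u := A.initOutWord (θ'.append u) ++ w) fun x => ?_
  have hgx : (f * g * f⁻¹) (η.concat x) = f ((θ'.append u).concat (y x)) := by
    change f (g (f.symm (η.concat x))) = _
    rw [hy, Word.concat_append, Word.concat_append, hθ']
  rw [hgx, prepend_append]
  refine hf.toSeq_eq hstate ?_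
  rw [hfy, Word.toSeq_concat, ← hw, prepend_append]

end Transducer

end Transducers

/-! ### Local actions of a homeomorphism -/

section LocalActions

variable {n r : ℕ} (f : Cantor n r ≃ₜ Cantor n r)

theorem finite_setOf_length_lt (L : ℕ) : {η : Word n r | η.2.length < L}.Finite :=
  (Set.finite_univ.prod (List.finite_length_lt (Fin n) L)).subset fun _ h => ⟨trivial, h⟩

/-- The restriction of `f` to the cone of `η`, as a family of sequences. -/
def restrict (η : Word n r) (x : ℕ → Fin n) : ℕ → Letter n r := (f (η.concat x)).toSeq

/-- The local action of `f` at `η`: the restriction of `f` to the cone of `η`, with `η` deleted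
from the arguments and the root of the image deleted from the values. -/
noncomputable def localAction (η : Word n r) : (ℕ → Fin n) → ℕ → Letter n r :=
  residual (restrict f η)

theorem restrict_injective (η : Word n r) : Function.Injective (restrict f η) := fun _ _ h =>
  η.concat_injective (f.injective (Cantor.toSeq_injective h))

variable [Nontrivial (Fin n)]

/-- The root of the image under `f` of the cone of `η`. -/
noncomputable def imageRoot (η : Word n r) : List (Letter n r) := commonPrefix (restrict f η)

theorem localAction_injective (η : Word n r) : Function.Injective (localAction f η) :=
  residual_injective (restrict_injective f η)

theorem restrict_eq (η : Word n r) (x : ℕ → Fin n) :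
    (f (η.concat x)).toSeq = prepend (imageRoot f η) (localAction f η x) :=
  (prepend_commonPrefix (restrict f η) x).symm

theorem restrict_append (η : Word n r) (w : List (Fin n)) :
    restrict f (η.append w) =
      fun x => prepend (imageRoot f η) (localAction f η (prepend w x)) := by
  funext x
  rw [restrict, Word.concat_append, restrict_eq]

theorem localAction_append (η : Word n r) (w : List (Fin n)) :
    localAction f (η.append w) = residual fun x => localAction f η (prepend w x) := by
  rw [localAction, restrict_append]
  exact residual_prepend ((localAction_injective f η).comp (prepend_injective w)) _

theorem imageRoot_append (η : Word n r) (w : List (Fin n)) :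
    imageRoot f (η.append w) =
      imageRoot f η ++ commonPrefix fun x => localAction f η (prepend w x) := by
  rw [imageRoot, restrict_append]
  exact commonPrefix_prepend ((localAction_injective f η).comp (prepend_injective w)) _

theorem isPrefix_imageRoot {η : Word n r} {u : List (Letter n r)}
    (hu : ∀ x, IsPrefixOf u (f (η.concat x)).toSeq) : u <+: imageRoot f η :=
  isPrefix_commonPrefix (restrict_injective f η) hu

theorem isPrefixOf_imageRoot (η : Word n r) (x : ℕ → Fin n) :
    IsPrefixOf (imageRoot f η) (f (η.concat x)).toSeq := by
  rw [restrict_eq]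
  exact isPrefixOf_prepend _ _

/-- The roots of the images of small cones are long. -/
theorem exists_lt_length_imageRoot (K : ℕ) :
    ∃ L, ∀ η : Word n r, L ≤ η.2.length → K < (imageRoot f η).length := by
  obtain ⟨L, hL⟩ := exists_level f.continuous K
  refine ⟨L, fun η hη => ?_⟩
  obtain ⟨ν, hν, hx⟩ := hL η hη
  have : ν.toList <+: imageRoot f η := isPrefix_imageRoot f fun x => by
    obtain ⟨y, hy⟩ := hx x
    rw [hy, Word.toSeq_concat]
    exact isPrefixOf_prepend _ _
  have := this.length_le
  rw [Word.length_toList] at this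
  omega

theorem finite_setOf_imageRoot_eq_nil : {η : Word n r | imageRoot f η = []}.Finite := by
  obtain ⟨L, hL⟩ := exists_lt_length_imageRoot f 0
  refine (finite_setOf_length_lt L).subset fun η hη => ?_
  by_contra hlt
  have := hL η (not_lt.1 hlt)
  rw [show imageRoot f η = [] from hη] at this
  simp at this

variable {f}

/-- In a minimal transducer, the output on reading `η` is the root of the image of the cone of
`η`, and the states are the local actions. -/
theorem Transducer.IsMinimal.writes_iff {P : Type*} {A : Transducer n r P} (hA : A.IsMinimal)
    (hf : A.Represents f) (η : Word n r) (x : ℕ → Fin n) (s : ℕ → Letter n r) :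
    A.Writes (A.initStepWord η) x s ↔ s = localAction f η x := by
  have hset : {s | ∃ x, A.InitWrites (η.concat x) s} = Set.range (restrict f η) := by
    ext s
    exact exists_congr fun x =>
      ⟨fun h => (hf _).unique h, fun h => h ▸ hf _⟩
  have hroot : A.initOutWord η = imageRoot f η := by
    by_contra hne
    refine hA.1 _ ⟨η, imageRoot f η, rfl, ?_, ?_, hne⟩
    · rw [hset]
      refine ⟨?_, fun u hu => isPrefix_imageRoot f fun x => hu _ ⟨x, rfl⟩⟩
      rintro _ ⟨x, rfl⟩
      exact isPrefixOf_imageRoot f η x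
    · refine isPrefix_imageRoot f fun x => ?_
      obtain ⟨t, ht, -⟩ := hf.exists_writes η x
      rw [ht]
      exact isPrefixOf_prepend _ _
  obtain ⟨t, ht, hw⟩ := hf.exists_writes η x
  rw [restrict_eq, hroot] at ht
  rw [prepend_injective _ ht]
  exact ⟨fun h => h.unique hw, fun h => h ▸ hw⟩

theorem Transducer.IsMinimal.initStepWord_eq_iff {P : Type*} {A : Transducer n r P}
    (hA : A.IsMinimal) (hf : A.Represents f) {η ζ : Word n r} :
    A.initStepWord η = A.initStepWord ζ ↔ localAction f η = localAction f ζ := by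
  constructor
  · intro h
    funext x
    rw [← hA.writes_iff hf ζ, ← h, hA.writes_iff hf]
  · intro h
    refine hA.2.2 _ _ fun x s => ?_
    rw [hA.writes_iff hf, hA.writes_iff hf, h]

theorem Transducer.IsMinimal.finite_range_localAction {P : Type*} [Finite P]
    {A : Transducer n r P} (hA : A.IsMinimal) (hf : A.Represents f) :
    (Set.range (localAction f)).Finite := by
  have : Set.range (localAction f) = Set.range fun q => localAction f (hA.2.1 q).choose := by
    ext l
    constructor
    · rintro ⟨η, rfl⟩
      exact ⟨A.initStepWord η,
        (hA.initStepWord_eq_iff hf).1 (hA.2.1 (A.initStepWord η)).choose_spec⟩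
    · rintro ⟨q, rfl⟩
      exact ⟨_, rfl⟩
  rw [this]
  exact Set.finite_range _

end LocalActions

/-! ### Synchronization of the local actions of a normalizing homeomorphism -/

section Synchronization

variable {n r : ℕ}

theorem Word.append_append (η : Word n r) (u v : List (Fin n)) :
    (η.append u).append v = η.append (u ++ v) :=
  Prod.ext rfl (List.append_assoc _ _ _)

theorem Word.not_isPrefix_of_ne {c d : Fin r} {a b : Fin n} (h : (c, a) ≠ (d, b))
    (u v : List (Fin n)) : ¬ Word.IsPrefix (c, a :: u) (d, b :: v) := fun ⟨h₁, h₂⟩ =>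
  h (Prod.ext h₁ (List.cons_prefix_cons.1 h₂).1)

/-- The local actions of `f` at `η` and at `ζ` become equal after all sufficiently long words. -/
def LocallySynchronized (f : Cantor n r ≃ₜ Cantor n r) (η ζ : Word n r) : Prop :=
  ∃ M, ∀ w : List (Fin n), M ≤ w.length →
    localAction f (η.append w) = localAction f (ζ.append w)

theorem LocallySynchronized.trans {f : Cantor n r ≃ₜ Cantor n r} {η ζ ξ : Word n r}
    (h₁ : LocallySynchronized f η ζ) (h₂ : LocallySynchronized f ζ ξ) :
    LocallySynchronized f η ξ := by
  obtain ⟨M₁, h₁⟩ := h₁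
  obtain ⟨M₂, h₂⟩ := h₂
  exact ⟨max M₁ M₂, fun w hw =>
    (h₁ w ((le_max_left _ _).trans hw)).trans (h₂ w ((le_max_right _ _).trans hw))⟩

variable [Nontrivial (Fin n)] {f : Cantor n r ≃ₜ Cantor n r}

/-- If `g` exchanges `η` and `ζ` and `f g f⁻¹` is a prefix code map, then `f` acts in the same
way on small cones inside those of `η` and `ζ`. -/
theorem locallySynchronized_of_incomparable
    (hf : ∀ g ∈ higmanThompson n r, f * g * f⁻¹ ∈ higmanThompson n r) {η ζ : Word n r}
    (h₁ : ¬ η.IsPrefix ζ) (h₂ : ¬ ζ.IsPrefix η) : LocallySynchronized f η ζ := by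
  obtain ⟨g, hg, hgx⟩ := exists_mem_higmanThompson_of_incomparable h₁ h₂
  obtain ⟨L, hL⟩ := exists_level_of_mem_higmanThompson (hf g hg)
  obtain ⟨M, hM⟩ := exists_level f.continuous L
  refine ⟨M, fun w hw => ?_⟩
  obtain ⟨ν, hν, hνx⟩ := hM (η.append w) (by simp only [Word.append, List.length_append]; omega)
  choose y hy using hνx
  obtain ⟨ν', hν'⟩ := hL ν hν.ge
  refine residual_eq_of_prepend (k := fun x i => Sum.inr (y x i)) (u := ν.toList)
    (u' := ν'.toList) (restrict_injective f _) (fun x => ?_) fun x => ?_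
  · rw [restrict, hy, Word.toSeq_concat]
  · rw [restrict, ← Word.toSeq_concat, ← hν', ← hy]
    change _ = (f (g (f.symm (f _)))).toSeq
    rw [Homeomorph.symm_apply_apply, Word.concat_append, Word.concat_append, hgx]

/-- Two words with the same first two letters are compared through a third word. -/
theorem locallySynchronized_cons
    (hf : ∀ g ∈ higmanThompson n r, f * g * f⁻¹ ∈ higmanThompson n r) (c d : Fin r) (a b : Fin n)
    (u v : List (Fin n)) : LocallySynchronized f (c, a :: u) (d, b :: v) := by
  have key : ∀ {c d : Fin r} {a b : Fin n} (u v : List (Fin n)), (c, a) ≠ (d, b) →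
      LocallySynchronized f (c, a :: u) (d, b :: v) := fun u v h =>
    locallySynchronized_of_incomparable hf (Word.not_isPrefix_of_ne h _ _)
      (Word.not_isPrefix_of_ne h.symm _ _)
  by_cases h : (c, a) = (d, b)
  · obtain ⟨e, he⟩ := exists_ne a
    have h₁ : (c, a) ≠ (c, e) := fun h' => he (Prod.ext_iff.1 h').2.symm
    exact (key u [] h₁).trans (key [] v (h ▸ h₁.symm))
  · exact key u v h

theorem locallySynchronized
    (hf : ∀ g ∈ higmanThompson n r, f * g * f⁻¹ ∈ higmanThompson n r) (η ζ : Word n r) :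
    LocallySynchronized f η ζ := by
  have h : ∀ a, LocallySynchronized f (η.append [a]) (ζ.append [a]) := fun a => by
    obtain ⟨c, u⟩ := η
    obtain ⟨d, v⟩ := ζ
    obtain ⟨b, u', hu⟩ := List.exists_cons_of_ne_nil (List.append_ne_nil_of_right_ne_nil u
      (List.cons_ne_nil a []))
    obtain ⟨e, v', hv⟩ := List.exists_cons_of_ne_nil (List.append_ne_nil_of_right_ne_nil v
      (List.cons_ne_nil a []))
    simp only [Word.append, hu, hv]
    exact locallySynchronized_cons hf _ _ _ _ _ _
  choose M hM using h
  -- The first letter makes both words longer than their dotted letter, so that neither cone is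
  -- the whole space.
  refine ⟨Finset.univ.sup M + 1, fun w hw => ?_⟩
  cases w with
  | nil => simp at hw
  | cons a w =>
    have := hM a w ((Finset.le_sup (Finset.mem_univ a)).trans (by simpa using hw))
    rwa [Word.append_append, Word.append_append] at this

/-- With finitely many local actions, the level of synchronization is uniform. -/
theorem exists_synchronizing_level
    (hf : ∀ g ∈ higmanThompson n r, f * g * f⁻¹ ∈ higmanThompson n r)
    (hfin : (Set.range (localAction f)).Finite) :
    ∃ M, ∀ (η ζ : Word n r) (w : List (Fin n)), M ≤ w.length →
      localAction f (η.append w) = localAction f (ζ.append w) := by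
  have := hfin.to_subtype
  choose rep hrep using fun l : Set.range (localAction f) => l.2
  choose M hM using fun η ζ => locallySynchronized hf η ζ
  obtain ⟨N, hN⟩ := (Set.finite_range
    fun l : Set.range (localAction f) × Set.range (localAction f) =>
      M (rep l.1) (rep l.2)).bddAbove
  refine ⟨N, fun η ζ w hw => ?_⟩
  have h := hM (rep ⟨_, η, rfl⟩) (rep ⟨_, ζ, rfl⟩) w
    ((hN ⟨(⟨_, η, rfl⟩, ⟨_, ζ, rfl⟩), rfl⟩).trans hw)
  simp only [localAction_append, hrep] at h
  rw [localAction_append, localAction_append, h]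

end Synchronization

/-! ### The local actions of the inverse -/

section Inverse

variable {n r : ℕ} [Nontrivial (Fin n)] (f : Cantor n r ≃ₜ Cantor n r)

/-- Some finite part of the value of a local action determines the first letter of the
argument. -/
theorem exists_depth_localAction (ν : Word n r) :
    ∃ K, ∀ z z', takePrefix (localAction f ν z) K = takePrefix (localAction f ν z') K →
      z 0 = z' 0 := by
  obtain ⟨K, hK⟩ := exists_depth f.symm.continuous (ν.2.length + 2)
  refine ⟨K, fun z z' h => ?_⟩
  have h₁ := hK (f (ν.concat z)) (f (ν.concat z')) (by
    rw [restrict_eq, restrict_eq]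
    have h' := congrArg (imageRoot f ν ++ ·) h
    simp only [← takePrefix_prepend_add] at h'
    exact takePrefix_eq_takePrefix_iff.2 fun i hi =>
      takePrefix_eq_takePrefix_iff.1 h' i (by omega))
  rw [Homeomorph.symm_apply_apply, Homeomorph.symm_apply_apply] at h₁
  have h₂ := Sum.inr_injective
    (takePrefix_eq_takePrefix_iff.1 h₁ (ν.2.length + 1) (Nat.lt_succ_self _))
  have h₃ : ∀ t, prepend ν.2 t ν.2.length = t 0 := fun t => by
    simpa using prepend_add_length ν.2 t 0
  exact (h₃ z).symm.trans (h₂.trans (h₃ z'))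

/-- Let `ν` be the root of the image of the cone of `η` under `f⁻¹`, a non-empty word. The local
action of `f⁻¹` at `η` is determined by the local action of `f` at `ν` and by the word `w` that
has to be written from there on in order to complete the output to `η`. -/
theorem exists_localAction_symm_eq {η : Word n r} (hη : imageRoot f.symm η ≠ []) :
    ∃ (ν : Word n r) (w : List (Letter n r)) (z : (ℕ → Fin n) → ℕ → Fin n),
      localAction f.symm η = (fun y i => Sum.inr (z y i)) ∧
        ∀ y, (prepend w fun i => Sum.inr (y i)) = localAction f ν (z y) := by
  obtain ⟨ν, hν⟩ :=
    (isPrefixOf_imageRoot f.symm η (Classical.arbitrary _)).exists_word hη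
  have hz : ∀ y, ∃ z, f.symm (η.concat y) = ν.concat z := fun y => by
    have h := isPrefixOf_imageRoot f.symm η y
    rw [hν, IsPrefixOf, Word.length_toList, Cantor.takePrefix_toSeq] at h
    exact mem_cone_iff.1 (Word.toList_injective h)
  choose z hz using hz
  have hfz : ∀ y, prepend (imageRoot f ν) (localAction f ν (z y)) =
      prepend η.toList fun i => Sum.inr (y i) := fun y => by
    rw [← restrict_eq, ← hz, Homeomorph.apply_symm_apply, Word.toSeq_concat]
  obtain ⟨w, hw⟩ : imageRoot f ν <+: η.toList :=
    isPrefix_of_forall_isPrefixOf (Sum.inr_injective (α := Fin r) (β := Fin n)) fun y => by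
      rw [← hfz]
      exact isPrefixOf_prepend _ _
  refine ⟨ν, w, z, funext fun y => ?_, fun y => ?_⟩
  · apply prepend_injective (imageRoot f.symm η)
    rw [← restrict_eq, hz, hν, Word.toSeq_concat]
  · apply prepend_injective (imageRoot f ν)
    rw [hfz, ← hw, prepend_append]

/-- If `f` has finitely many local actions, then so has its inverse: in the description of
`exists_localAction_symm_eq` the word `w` is shorter than the part of the output which determines
the next letter of the input, since the values of a local action have no common first letter. -/
theorem finite_range_localAction_symm (hfin : (Set.range (localAction f)).Finite) :
    (Set.range (localAction f.symm)).Finite := by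
  have hK : ∀ l ∈ Set.range (localAction f), ∃ K, ∀ z z',
      takePrefix (l z) K = takePrefix (l z') K → z 0 = z' 0 := by
    rintro _ ⟨ν, rfl⟩
    exact exists_depth_localAction f ν
  choose! K hK using hK
  let T : Set (((ℕ → Fin n) → ℕ → Letter n r) × List (Letter n r)) :=
    ⋃ l ∈ Set.range (localAction f), {l} ×ˢ {w | w.length < K l}
  have hT : T.Finite := hfin.biUnion fun l _ =>
    (Set.finite_singleton l).prod (List.finite_length_lt _ _)
  let S : Set (Word n r) := {η | imageRoot f.symm η = []}
  have key : ∀ h ∈ localAction f.symm '' Sᶜ, ∃ t ∈ T, ∃ z : (ℕ → Fin n) → ℕ → Fin n,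
      h = (fun y i => Sum.inr (z y i)) ∧
        ∀ y, (prepend t.2 fun i => Sum.inr (y i)) = t.1 (z y) := by
    rintro _ ⟨η, hη, rfl⟩
    obtain ⟨ν, w, z, h₁, h₂⟩ := exists_localAction_symm_eq f hη
    refine ⟨(localAction f ν, w), Set.mem_biUnion ⟨ν, rfl⟩ ⟨rfl, ?_⟩, z, h₁, h₂⟩
    -- Otherwise all values of the local action of `f⁻¹` at `η` start with the same letter.
    by_contra hlt
    replace hlt : K (localAction f ν) ≤ w.length := not_lt.1 hlt
    obtain ⟨x, y, hxy⟩ := exists_ne_commonLength (restrict_injective f.symm η)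
    have hne : localAction f.symm η x 0 ≠ localAction f.symm η y 0 := by
      simpa only [localAction, residual, zero_add] using hxy
    rw [h₁] at hne
    refine hne (congrArg Sum.inr (hK _ ⟨ν, rfl⟩ _ _ ?_))
    rw [← h₂, ← h₂, takePrefix_eq_takePrefix_iff]
    exact fun i hi => prepend_of_lt _ _ _ (by omega)
  -- An element of `T` comes from at most one local action, since those of `f` are injective.
  choose! k hkT hk using key
  have himage : (localAction f.symm '' Sᶜ).Finite := by
    refine Set.Finite.of_injOn hkT (fun h hh h' hh' heq => ?_) hT
    obtain ⟨z, rfl, hz⟩ := hk h hh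
    obtain ⟨z', rfl, hz'⟩ := hk h' hh'
    obtain ⟨l, ⟨ν, hl⟩, ht⟩ := Set.mem_iUnion₂.1 (hkT _ hh)
    have hinj : Function.Injective (k fun y i => Sum.inr (z y i)).1 := by
      rw [show (k fun y i => Sum.inr (z y i)).1 = l from ht.1, ← hl]
      exact localAction_injective f ν
    have : z = z' := funext fun y => hinj (by rw [← hz, heq, hz'])
    rw [this]
  rw [← Set.image_univ, ← Set.union_compl_self S, Set.image_union]
  exact ((finite_setOf_imageRoot_eq_nil f.symm).image _).union himage

end Inverse

/-! ### The transducer of local actions -/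

section Canonical

variable {n r : ℕ} [Nontrivial (Fin n)] (f : Cantor n r ≃ₜ Cantor n r)

/-- The state `η` of the transducer of local actions. -/
noncomputable def actionState (η : Word n r) : Set.range (localAction f) := ⟨_, η, rfl⟩

/-- The data of the transducer whose states are the local actions of `f`: on reading `a`, it
writes the part of the output which is determined by `a`. The states in `R` are those whose
values start with dotted letters. -/
noncomputable def actionData : TransducerData n r (Set.range (localAction f)) where
  R := {q | ∃ x c, q.1 x 0 = Sum.inl c}
  initStep c := actionState f (c, [])
  initOut c := imageRoot f (c, [])
  step a q := ⟨residual fun x => q.1 (prepend [a] x), by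
    obtain ⟨_, η, rfl⟩ := q
    exact ⟨η.append [a], localAction_append f η [a]⟩⟩
  out a q := commonPrefix fun x => q.1 (prepend [a] x)

theorem actionData_step (a : Fin n) (η : Word n r) :
    (actionData f).step a (actionState f η) = actionState f (η.append [a]) :=
  Subtype.ext (localAction_append f η [a]).symm

theorem imageRoot_append_out (a : Fin n) (η : Word n r) :
    imageRoot f η ++ (actionData f).out a (actionState f η) = imageRoot f (η.append [a]) :=
  (imageRoot_append f η [a]).symm

theorem actionData_stepWord (w : List (Fin n)) (η : Word n r) :
    (actionData f).stepWord w (actionState f η) = actionState f (η.append w) := by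
  induction w generalizing η with
  | nil => simp [TransducerData.stepWord, Word.append]
  | cons a w ih =>
    rw [TransducerData.stepWord, actionData_step, ih, Word.append_append]
    rfl

theorem imageRoot_append_outWord (w : List (Fin n)) (η : Word n r) :
    imageRoot f η ++ (actionData f).outWord w (actionState f η) = imageRoot f (η.append w) := by
  induction w generalizing η with
  | nil => simp [TransducerData.outWord, Word.append]
  | cons a w ih =>
    rw [TransducerData.outWord, ← List.append_assoc, imageRoot_append_out, actionData_step, ih,
      Word.append_append]
    rfl

theorem initOutWord_actionData (η : Word n r) :
    (actionData f).initOutWord η = imageRoot f η :=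
  imageRoot_append_outWord f η.2 (η.1, [])

theorem actionState_mem_R {η : Word n r} :
    actionState f η ∈ (actionData f).R ↔ imageRoot f η = [] := by
  have h : ∀ x, prepend (imageRoot f η) (localAction f η x) = (f (η.concat x)).toSeq :=
    fun x => (restrict_eq f η x).symm
  constructor
  · rintro ⟨x, c, hc⟩
    by_contra hne
    obtain ⟨k, hk⟩ := Nat.exists_eq_succ_of_ne_zero (List.length_pos_iff.2 hne).ne'
    have h₁ := prepend_add_length (imageRoot f η) (localAction f η x) 0
    rw [h, zero_add, hk, show localAction f η x 0 = _ from hc] at h₁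
    exact Sum.inr_ne_inl h₁
  · intro hnil
    refine ⟨Classical.arbitrary _, (f (η.concat (Classical.arbitrary _))).1, ?_⟩
    have h₁ := h (Classical.arbitrary _)
    rw [hnil, prepend_nil] at h₁
    exact congrFun h₁ 0

theorem exists_imageRoot_eq_toList {η : Word n r} (h : imageRoot f η ≠ []) :
    ∃ ν : Word n r, imageRoot f η = ν.toList :=
  (isPrefixOf_imageRoot f η (Classical.arbitrary _)).exists_word h

theorem actionData_writes (η : Word n r) (x : ℕ → Fin n) :
    (actionData f).Writes (actionState f η) x (localAction f η x) := by
  have hpre : ∀ k, IsPrefixOf ((actionData f).outWord (takePrefix x k) (actionState f η))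
      (localAction f η x) := fun k => by
    rw [← isPrefixOf_append_prepend (u := imageRoot f η), imageRoot_append_outWord, ← restrict_eq]
    have := isPrefixOf_imageRoot f (η.append (takePrefix x k)) fun i => x (i + k)
    rwa [Word.concat_append, prepend_takePrefix] at this
  refine ⟨hpre, fun l => ?_⟩
  obtain ⟨L, hL⟩ := exists_lt_length_imageRoot f ((imageRoot f η).length + l)
  refine ⟨L, ?_⟩
  have := hL (η.append (takePrefix x L)) (by simp [Word.append])
  rw [← imageRoot_append_outWord, List.length_append] at this
  exact (Nat.lt_of_add_lt_add_left this).le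

/-- The transducer of local actions. -/
noncomputable def actionTransducer : Transducer n r (Set.range (localAction f)) where
  toTransducerData := actionData f
  finite_R := by
    refine ((finite_setOf_imageRoot_eq_nil f).image (actionState f)).subset ?_
    rintro ⟨_, η, rfl⟩ hq
    exact ⟨η, (actionState_mem_R f).1 hq, rfl⟩
  countable_S := by
    have : Countable (Set.range (localAction f)) := (Set.countable_range _).to_subtype
    exact Set.to_countable _
  initOut_R c hc := (actionState_mem_R f).1 hc
  out_R := by
    rintro a ⟨_, η, rfl⟩ hq
    have hq' : actionState f (η.append [a]) ∈ (actionData f).R := actionData_step f a η ▸ hq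
    rw [actionState_mem_R, ← imageRoot_append_out, List.append_eq_nil_iff] at hq'
    exact ⟨(actionState_mem_R f).2 hq'.1, hq'.2⟩
  initOut_S c hc := by
    obtain ⟨ν, hν⟩ := exists_imageRoot_eq_toList f (mt (actionState_mem_R f).2 hc)
    exact ⟨ν.1, ν.2, hν⟩
  out_R_S := by
    rintro a ⟨_, η, rfl⟩ hq hq'
    have hq' : actionState f (η.append [a]) ∉ (actionData f).R := actionData_step f a η ▸ hq'
    obtain ⟨ν, hν⟩ := exists_imageRoot_eq_toList f (mt (actionState_mem_R f).2 hq')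
    rw [← imageRoot_append_out, (actionState_mem_R f).1 hq, List.nil_append] at hν
    exact ⟨ν.1, ν.2, hν⟩
  out_S := by
    rintro a ⟨_, η, rfl⟩ hq
    have hne := mt (actionState_mem_R f).2 hq
    obtain ⟨μ, hμ⟩ := exists_imageRoot_eq_toList f hne
    have happ := imageRoot_append_out f a η
    obtain ⟨ν, hν⟩ := exists_imageRoot_eq_toList f (η := η.append [a])
      (by rw [← happ]; exact List.append_ne_nil_of_left_ne_nil hne _)
    rw [hμ, hν] at happ
    obtain ⟨_, u, -, -, hu⟩ := List.append_eq_map_iff.1 (List.cons.inj happ).2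
    exact ⟨u, hu.symm⟩
  out_circuit := by
    -- A circuit without output would make `f` take the same value at `η ^ w ^ x` and `η ^ x`.
    rintro ⟨_, η, rfl⟩ w hw hstep hout
    have h₁ : localAction f (η.append w) = localAction f η :=
      congrArg Subtype.val ((actionData_stepWord f w η).symm.trans hstep)
    have h₂ : imageRoot f (η.append w) = imageRoot f η := by
      rw [← imageRoot_append_outWord]
      exact (congrArg _ hout).trans (List.append_nil _)
    obtain ⟨a, u, rfl⟩ := List.exists_cons_of_ne_nil hw
    obtain ⟨b, hb⟩ := exists_ne a
    have h₃ : f ((η.append (a :: u)).concat fun _ => b) = f (η.concat fun _ => b) :=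
      Cantor.toSeq_injective (by rw [restrict_eq, restrict_eq, h₁, h₂])
    have h₄ := f.injective h₃
    rw [Word.concat_append] at h₄
    exact hb (congrFun (η.concat_injective h₄) 0).symm
  out_infinite := by
    rintro ⟨_, η, rfl⟩ hq x
    obtain ⟨μ, hμ⟩ := exists_imageRoot_eq_toList f (mt (actionState_mem_R f).2 hq)
    have h : (f (η.concat x)).toSeq = prepend μ.toList (localAction f η x) := hμ ▸ restrict_eq f η x
    refine ⟨fun i => (f (η.concat x)).2 (i + μ.2.length), ?_⟩
    have h' : localAction f η x = fun i => Sum.inr ((f (η.concat x)).2 (i + μ.2.length)) := by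
      funext i
      rw [← prepend_add_length μ.toList (localAction f η x) i, ← h, Word.length_toList]
      rfl
    exact h' ▸ actionData_writes f η x

theorem actionTransducer_represents : (actionTransducer f).Represents f := by
  refine fun p => ⟨fun k => ?_, fun l => ?_⟩
  · have := isPrefixOf_imageRoot f (p.take k) fun i => p.2 (i + k)
    rw [Cantor.concat_take, ← initOutWord_actionData] at this
    exact this
  · obtain ⟨L, hL⟩ := exists_lt_length_imageRoot f l
    refine ⟨L, ?_⟩
    have := hL (p.take L) (by simp)
    rw [← initOutWord_actionData] at this
    exact this.le

theorem actionTransducer_isSynchronizingAt {m : ℕ} (hm : 0 < m)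
    (h : ∀ (η ζ : Word n r) (w : List (Fin n)), w.length = m →
      localAction f (η.append w) = localAction f (ζ.append w)) :
    (actionTransducer f).IsSynchronizingAt m := by
  refine ⟨hm, ?_⟩
  rintro w hw ⟨_, η, rfl⟩ ⟨_, ζ, rfl⟩
  refine (actionData_stepWord f w η).trans (Eq.trans ?_ (actionData_stepWord f w ζ).symm)
  exact Subtype.ext (h η ζ w hw)

end Canonical

/-! ### Normalizing homeomorphisms and bi-synchronizing transducers -/

section Normalizer

variable {n r : ℕ} [Nontrivial (Fin n)] {φ : Cantor n r ≃ₜ Cantor n r} {P : Type*}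
  {A : Transducer n r P}

theorem Transducer.IsBiSynchronizingAt.mem_normalizer {m : ℕ} (h : A.IsBiSynchronizingAt φ m) :
    φ ∈ Subgroup.normalizer (higmanThompson n r) := by
  obtain ⟨hA, hAm, P', B, hB, hBm⟩ := h
  refine fun g => ⟨fun hg => hAm.conj_mem hA hg, fun hg => ?_⟩
  have h := hBm.conj_mem (f := φ⁻¹) hB hg
  rwa [show φ⁻¹ * (φ * g * φ⁻¹) * φ⁻¹⁻¹ = g by group] at h

theorem Transducer.IsMinimal.exists_isBiSynchronizingAt [Finite P] (hmin : A.IsMinimal)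
    (hrep : A.Represents φ) (hφ : φ ∈ Subgroup.normalizer (higmanThompson n r)) :
    ∃ m, A.IsBiSynchronizingAt φ m := by
  have h₁ : ∀ g ∈ higmanThompson n r, φ * g * φ⁻¹ ∈ higmanThompson n r := fun g => (hφ g).1
  have h₂ : ∀ g ∈ higmanThompson n r, φ.symm * g * φ.symm⁻¹ ∈ higmanThompson n r := fun g =>
    (inv_mem hφ g).1
  have hfin := hmin.finite_range_localAction hrep
  obtain ⟨M₁, hM₁⟩ := exists_synchronizing_level h₁ hfin
  obtain ⟨M₂, hM₂⟩ := exists_synchronizing_level h₂ (finite_range_localAction_symm φ hfin)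
  -- The levels are increased by one, since synchronization at level `0` is not admitted.
  have hA : A.IsSynchronizingAt (M₁ + 1) := by
    refine ⟨Nat.succ_pos _, fun w hw p q => ?_⟩
    obtain ⟨η, rfl⟩ := hmin.2.1 p
    obtain ⟨ζ, rfl⟩ := hmin.2.1 q
    rw [← A.initStepWord_append, ← A.initStepWord_append, hmin.initStepWord_eq_iff hrep]
    exact hM₁ η ζ w (by omega)
  have hB : (actionTransducer φ.symm).IsSynchronizingAt (M₂ + 1) :=
    actionTransducer_isSynchronizingAt _ (Nat.succ_pos _) fun η ζ w hw => hM₂ η ζ w (by omega)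
  exact ⟨max (M₁ + 1) (M₂ + 1), hrep, hA.mono (le_max_left _ _), _, actionTransducer φ.symm,
    actionTransducer_represents _, hB.mono (le_max_right _ _)⟩

end Normalizer

end HigmanThompson

theorem mainTheorem3 {n r : ℕ} (hr : 1 ≤ r) (hrn : r < n)
    (φ : HigmanThompson.Cantor n r ≃ₜ HigmanThompson.Cantor n r)
    {P : Type*} [Finite P] (A : HigmanThompson.Transducer n r P)
    (hmin : A.IsMinimal) (hrep : A.Represents φ) :
    (∃ m : ℕ, A.IsBiSynchronizingAt φ m) ↔
      φ ∈ Subgroup.normalizer (HigmanThompson.higmanThompson n r) := by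
  have : Nontrivial (Fin n) := Fin.nontrivial_iff_two_le.2 (by omega)
  exact ⟨fun ⟨_, h⟩ => h.mem_normalizer, hmin.exists_isBiSynchronizingAt hrep⟩
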